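/- Let $n,d\ge 0$ be integers and let the operators on $\mathbb C^d$ and on tensor products of copies of it be written as matrices in the computational basis. For a density matrix $\rho$ on $\mathcal H=(\mathbb C^d)^{\otimes n}$, let $|\psi^{\mathrm{std}}_\rho\rangle=(\sqrt\rho\otimes I)\sum_{x}|x\rangle\otimes|x\rangle\in\mathcal H\otimes\mathcal H$, where $x$ ranges over the computational basis of $\mathcal H$, and let $\psi^{\mathrm{std}}_\rho=|\psi^{\mathrm{std}}_\rho\rangle\langle\psi^{\mathrm{std}}_\rho|$. Identify $(\mathbb C^d)^{\otimes n}\otimes(\mathbb C^d)^{\otimes n}$ with $(\mathbb C^d\otimes\mathbb C^d)^{\otimes n}$ by reordering tensor factors. Let $dU$ denote the Haar probability measure on $\mathrm U(d)$. Call $\rho$ permutation-invariant if it commutes with the operators permuting the $n$ tensor factors. There is a quantum channel (a completely positive trace-preserving linear map) $\mathcal P^{\mathrm{Purify}}_{n,d}$ from the operators on $(\mathbb C^d)^{\otimes n}$ to the operators on the symmetric subspace of $(\mathbb C^d\otimes\mathbb C^d)^{\otimes n}$ such that: 1. for every permutation-invariant density matrix $\rho$ on $(\mathbb C^d)^{\otimes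 n}$, $$\mathcal P^{\mathrm{Purify}}_{n,d}[\rho]=\int_{\mathrm U(d)}(I\otimes U^{\otimes n})\,\psi^{\mathrm{std}}_{\rho}\,(I\otimes U^{\dagger\otimes n})\,dU;$$ 2. for every density matrix $\sigma$ on $\mathbb C^d$, $$\mathcal P^{\mathrm{Purify}}_{n,d}[\sigma^{\otimes n}]=\int_{\mathrm U(d)}(I\otimes U^{\otimes n})\,\psi^{\mathrm{std}}_{\sigma^{\otimes n}}\,(I\otimes U^{\dagger\otimes n})\,dU=\mathop{\mathbf E}_{\psi_\sigma}\,\psi_\sigma^{\otimes n},$$ where $\psi_\sigma=|\psi_\sigma\rangle\langle\psi_\sigma|$ and the expectation is over a uniformly random purification of $\sigma$, that is, over the unique probability measure on the set of vectors $|\psi_\sigma\rangle\in\mathbb C^d\otimes\mathbb C^d$ with $\operatorname{tr}_2|\psi_\sigma\rangle\langle\psi_\sigma|=\sigma$ that is invariant under $I\otimes U$ for all $U\in\mathrm U(d)$; in particular, this measure exists and is unique. -/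

import Mathlib

open MeasureTheory

/-! Operators on a space with a fixed orthonormal basis indexed by `ι` are matrices over `ι`.
The computational basis of the `n`-fold tensor power is indexed by `Fin n → ι`, and that of a
tensor product by a product type. -/

namespace RandomPurification

/-- `(ℂ^ι)^{⊗n}` as index type of its computational basis. -/
abbrev Word (n : ℕ) (ι : Type) : Type := Fin n → ι

section Haar

/-- The unitary group is compact. -/
instance compactSpace_unitaryGroup (d : ℕ) :
    CompactSpace (Matrix.unitaryGroup (Fin d) ℂ) := by
  refine (isCompact_iff_compactSpace
    (s := (Matrix.unitaryGroup (Fin d) ℂ : Set (Matrix (Fin d) (Fin d) ℂ)))).mp ?_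
  have hK : IsCompact (Set.pi Set.univ fun _ : Fin d => Set.pi Set.univ fun _ : Fin d =>
      Metric.closedBall (0 : ℂ) 1) :=
    isCompact_univ_pi fun _ => isCompact_univ_pi fun _ => isCompact_closedBall (0 : ℂ) 1
  refine hK.of_isClosed_subset ?_ ?_
  · have h1 : ((Matrix.unitaryGroup (Fin d) ℂ : Set (Matrix (Fin d) (Fin d) ℂ)))
        = {A | A * star A = 1} := by
      ext A
      exact Matrix.mem_unitaryGroup_iff
    rw [h1]
    exact isClosed_eq (by fun_prop) continuous_const
  · intro A hA i _ j _
    simpa using entry_norm_bound_of_unitary hA i j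

noncomputable instance measurableSpace_unitaryGroup (d : ℕ) :
    MeasurableSpace (Matrix.unitaryGroup (Fin d) ℂ) := borel _

instance borelSpace_unitaryGroup (d : ℕ) :
    BorelSpace (Matrix.unitaryGroup (Fin d) ℂ) := ⟨rfl⟩

/-- The Haar measure on `U(d)`, normalized to total mass one. -/
noncomputable def haarUnitary (d : ℕ) : Measure (Matrix.unitaryGroup (Fin d) ℂ) :=
  Measure.haarMeasure ⊤

end Haar

end RandomPurification

open scoped Kronecker ComplexOrder MatrixOrder Matrix.Norms.L2Operator CStarAlgebra

namespace RandomPurification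

/-- Density matrices. -/
structure IsState {ι : Type} [Fintype ι] (ρ : Matrix ι ι ℂ) : Prop where
  posSemidef : ρ.PosSemidef
  trace_eq_one : ρ.trace = 1

/-- `A^{⊗n}`. -/
def tensorPow {ι : Type} (n : ℕ) (A : Matrix ι ι ℂ) : Matrix (Word n ι) (Word n ι) ℂ :=
  Matrix.of fun x y => ∏ i, A (x i) (y i)

/-- The permutation operator `R_π |y₁,…,yₙ⟩ = |y_{π⁻¹(1)},…,y_{π⁻¹(n)}⟩`. -/
def permOp {ι : Type} [DecidableEq ι] {n : ℕ} (π : Equiv.Perm (Fin n)) :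
    Matrix (Word n ι) (Word n ι) ℂ :=
  Matrix.of fun x y => if x = fun i => y (π⁻¹ i) then 1 else 0

/-- Permutation-invariance of an operator: it commutes with all permutation operators. -/
def IsPermInvariant {ι : Type} [Fintype ι] [DecidableEq ι] {n : ℕ}
    (ρ : Matrix (Word n ι) (Word n ι) ℂ) : Prop :=
  ∀ π : Equiv.Perm (Fin n), permOp π * ρ = ρ * permOp π

/-- The symmetric subspace of the `n`-fold tensor power. -/
def symSubspace (n : ℕ) (ι : Type) [Fintype ι] [DecidableEq ι] :
    Submodule ℂ (Word n ι → ℂ) where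
  carrier := {v | ∀ π : Equiv.Perm (Fin n), Matrix.mulVec (permOp π) v = v}
  add_mem' := by
    intro v w hv hw π
    rw [Matrix.mulVec_add, hv π, hw π]
  zero_mem' := by
    intro π
    rw [Matrix.mulVec_zero]
  smul_mem' := by
    intro c v hv π
    rw [Matrix.mulVec_smul, hv π]

/-- `A` is an operator on the subspace `V` (extended by zero to the orthogonal complement):
the ranges of `A` and of its adjoint lie in `V`. -/
def SupportedOn {κ : Type} [Fintype κ] (V : Submodule ℂ (κ → ℂ)) (A : Matrix κ κ ℂ) : Prop :=
  (∀ v, Matrix.mulVec A v ∈ V) ∧ ∀ v, Matrix.mulVec A.conjTranspose v ∈ V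

/-- The rank-one operator `|ψ⟩⟨ψ|`. -/
def proj {κ : Type} (ψ : κ → ℂ) : Matrix κ κ ℂ := Matrix.vecMulVec ψ (star ψ)

/-- The unnormalized maximally entangled vector `∑ₓ |x x⟩`. -/
def maxEnt (ι : Type) [DecidableEq ι] : ι × ι → ℂ := fun p => if p.1 = p.2 then 1 else 0

/-- The standard purification vector `(√ρ ⊗ I) ∑ₓ |x x⟩`. -/
noncomputable def stdPurification {ι : Type} [Fintype ι] [DecidableEq ι] (ρ : Matrix ι ι ℂ) :
    ι × ι → ℂ :=
  Matrix.mulVec (CFC.sqrt ρ ⊗ₖ (1 : Matrix ι ι ℂ)) (maxEnt ι)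

/-- The identification of operators on `(ℂ^ι)^{⊗n} ⊗ (ℂ^ι)^{⊗n}` with operators on
`(ℂ^ι ⊗ ℂ^ι)^{⊗n}`, by reordering the tensor factors. -/
def regroup {ι : Type} {n : ℕ} (A : Matrix (Word n ι × Word n ι) (Word n ι × Word n ι) ℂ) :
    Matrix (Word n (ι × ι)) (Word n (ι × ι)) ℂ :=
  A.submatrix (fun f => (fun i => (f i).1, fun i => (f i).2))
    (fun f => (fun i => (f i).1, fun i => (f i).2))

/-- `(I ⊗ U^{⊗n}) ψ (I ⊗ U^{†⊗n})` for the standard purification `ψ` of `ρ`. -/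
noncomputable def rotatedStd {n d : ℕ} (ρ : Matrix (Word n (Fin d)) (Word n (Fin d)) ℂ)
    (U : Matrix.unitaryGroup (Fin d) ℂ) :
    Matrix (Word n (Fin d) × Word n (Fin d)) (Word n (Fin d) × Word n (Fin d)) ℂ :=
  ((1 : Matrix (Word n (Fin d)) (Word n (Fin d)) ℂ) ⊗ₖ
      tensorPow n (U : Matrix (Fin d) (Fin d) ℂ)) *
    proj (stdPurification ρ) *
    ((1 : Matrix (Word n (Fin d)) (Word n (Fin d)) ℂ) ⊗ₖ
      tensorPow n (U : Matrix (Fin d) (Fin d) ℂ).conjTranspose)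

/-- The partial trace over the second tensor factor. -/
def partialTrace {ι κ : Type} [Fintype κ] (A : Matrix (ι × κ) (ι × κ) ℂ) : Matrix ι ι ℂ :=
  Matrix.of fun x y => ∑ z, A (x, z) (y, z)

/-- The vectors of `ℂ^d ⊗ ℂ^d` whose reduced state on the first factor is `σ`. -/
def purifications {d : ℕ} (σ : Matrix (Fin d) (Fin d) ℂ) : Set (Fin d × Fin d → ℂ) :=
  {ψ | partialTrace (proj ψ) = σ}

/-- `ν` is a uniform distribution on the purifications of `σ`: a probability measure
on the set of purifications that is invariant under all unitaries of the purifying system. -/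
structure IsUniformPurification {d : ℕ} (σ : Matrix (Fin d) (Fin d) ℂ)
    (ν : Measure (Fin d × Fin d → ℂ)) : Prop where
  isProbability : IsProbabilityMeasure ν
  ae_mem : ∀ᵐ ψ ∂ν, ψ ∈ purifications σ
  invariant : ∀ U : Matrix.unitaryGroup (Fin d) ℂ,
    ν.map (fun ψ => Matrix.mulVec
      ((1 : Matrix (Fin d) (Fin d) ℂ) ⊗ₖ (U : Matrix (Fin d) (Fin d) ℂ)) ψ) = ν

end RandomPurification

/-! Let `Ω` be the projector onto the unnormalized maximally entangled vector, and let `T` (`twirl`)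
be its Haar average over the rotations `I ⊗ U^{⊗n}`. The channel is `X ↦ √T (X ⊗ I) √T`, up to
regrouping of factors. This is completely positive by its form and preserves the trace because `tr₂
T = I`. It lands in the symmetric subspace because `R_π ⊗ R_π` fixes `T`, hence `√T`.

The crux is that `T` commutes with `A ⊗ I` for every permutation-invariant `A` (`twirl_commute`).
For `A = V^{⊗n}` with `V` unitary, the transpose trick moves `V` to the second half, where Haar
invariance absorbs it. Such powers span all permutation-invariant operators
(`IsPermInvariant.mem_unitarySpan`), which is one half of Schur–Weyl duality. Hence `√T (ρ ⊗ I) √T =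
(√ρ ⊗ I) T (√ρ ⊗ I)`, and the right side is the twirled standard purification.

For `ρ = σ^{⊗n}` the standard purification is itself an `n`-th tensor power. The uniform law on
purifications of `σ` is the Haar image on one orbit, unique because `U(d)` acts transitively on
purifications (`exists_unitary_mulVec_eq`). -/

namespace RandomPurification

/-! ### Tensor powers of unitaries span the permutation-invariant operators. -/

section TensorPow

variable {ι : Type} {n : ℕ}

lemma tensorPow_apply (A : Matrix ι ι ℂ) (x y : Word n ι) :
    tensorPow n A x y = ∏ i, A (x i) (y i) := rfl

lemma tensorPow_mul [Fintype ι] (A B : Matrix ι ι ℂ) :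
    tensorPow n (A * B) = tensorPow n A * tensorPow n B := by
  classical
  ext x y
  simp only [tensorPow_apply, Matrix.mul_apply]
  rw [Finset.prod_univ_sum, Fintype.piFinset_univ]
  simp only [Finset.prod_mul_distrib]

lemma tensorPow_one [DecidableEq ι] : tensorPow n (1 : Matrix ι ι ℂ) = 1 := by
  ext x y
  rw [tensorPow_apply]
  by_cases h : x = y
  · subst h
    rw [Matrix.one_apply_eq]
    exact Finset.prod_eq_one fun i _ => Matrix.one_apply_eq _
  · obtain ⟨i, hi⟩ := Function.ne_iff.mp h
    rw [Matrix.one_apply_ne h]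
    exact Finset.prod_eq_zero (Finset.mem_univ i) (Matrix.one_apply_ne hi)

lemma tensorPow_conjTranspose (A : Matrix ι ι ℂ) :
    tensorPow n A.conjTranspose = (tensorPow n A).conjTranspose := by
  ext x y
  simp [tensorPow_apply, Matrix.conjTranspose_apply]

lemma trace_tensorPow [Fintype ι] (A : Matrix ι ι ℂ) :
    (tensorPow n A).trace = A.trace ^ n := by
  classical
  simp only [Matrix.trace, Matrix.diag, tensorPow_apply]
  rw [← Fin.prod_const, Finset.prod_univ_sum, Fintype.piFinset_univ]

lemma permOp_mul_apply [Fintype ι] [DecidableEq ι] {κ : Type} (π : Equiv.Perm (Fin n))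
    (A : Matrix (Word n ι) κ ℂ) (x : Word n ι) (y : κ) :
    ((permOp π : Matrix (Word n ι) (Word n ι) ℂ) * A) x y = A (fun i => x (π i)) y := by
  rw [Matrix.mul_apply, Finset.sum_eq_single (fun i => x (π i))]
  · simp [permOp]
  · intro z _ hz
    rw [permOp, Matrix.of_apply, if_neg, zero_mul]
    rintro rfl
    exact hz (by simp)
  · simp

lemma mul_permOp_apply [Fintype ι] [DecidableEq ι] {κ : Type} (π : Equiv.Perm (Fin n))
    (A : Matrix κ (Word n ι) ℂ) (x : κ) (y : Word n ι) :
    (A * (permOp π : Matrix (Word n ι) (Word n ι) ℂ)) x y = A x (fun i => y (π⁻¹ i)) := by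
  rw [Matrix.mul_apply, Finset.sum_eq_single (fun i => y (π⁻¹ i))]
  · simp [permOp]
  · intro z _ hz
    rw [permOp, Matrix.of_apply, if_neg hz, mul_zero]
  · simp

lemma IsPermInvariant.apply_comp [Fintype ι] [DecidableEq ι] {A : Matrix (Word n ι) (Word n ι) ℂ}
    (hA : IsPermInvariant A) (π : Equiv.Perm (Fin n)) (x y : Word n ι) :
    A (fun i => x (π i)) (fun i => y (π i)) = A x y := by
  have h := congrFun (congrFun (hA π) x) (fun i => y (π i))
  rw [permOp_mul_apply, mul_permOp_apply] at h
  simpa using h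

lemma isPermInvariant_tensorPow [Fintype ι] [DecidableEq ι] (A : Matrix ι ι ℂ) :
    IsPermInvariant (tensorPow n A) := by
  intro π
  ext x y
  rw [permOp_mul_apply, mul_permOp_apply, tensorPow_apply, tensorPow_apply,
    ← Equiv.prod_comp π (fun i => A (x i) (y (π⁻¹ i)))]
  simp

/-- Two words with the same letter counts differ by a permutation of positions. -/
lemma exists_perm_of_sum_single_eq {J : Type} {w w' : Fin n → J}
    (h : ∑ i, Finsupp.single (w i) 1 = (∑ i, Finsupp.single (w' i) 1 : J →₀ ℕ)) :
    ∃ π : Equiv.Perm (Fin n), ∀ i, w' (π i) = w i := by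
  classical
  have hc : ∀ j, Nonempty ({i // w i = j} ≃ {i // w' i = j}) := by
    intro j
    have hj := DFunLike.congr_fun h j
    simp only [Finsupp.coe_finsetSum, Finset.sum_apply, Finsupp.single_apply] at hj
    refine ⟨Fintype.equivOfCardEq ?_⟩
    rw [Fintype.card_subtype, Fintype.card_subtype, Finset.card_filter, Finset.card_filter]
    exact hj
  have e := fun j => Classical.choice (hc j)
  -- Bijections between the positions of each letter in the two words are glued into one
  -- permutation.
  refine ⟨(Equiv.sigmaFiberEquiv w).symm.trans
    ((Equiv.sigmaCongrRight e).trans (Equiv.sigmaFiberEquiv w')), fun i => ?_⟩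
  exact (e (w i) ⟨i, rfl⟩).2

/-- If a homogeneous form with coefficients `c` vanishes identically, then `c` is orthogonal
to every symmetric tensor. -/
lemma sum_mul_eq_zero_of_forall_sum_mul_prod_eq_zero {J : Type} [Fintype J]
    (c T : (Fin n → J) → ℂ) (hc : ∀ z : J → ℂ, ∑ w, c w * ∏ i, z (w i) = 0)
    (hT : ∀ (π : Equiv.Perm (Fin n)) w, T (fun i => w (π i)) = T w) :
    ∑ w, c w * T w = 0 := by
  classical
  let m : (Fin n → J) → (J →₀ ℕ) := fun w => ∑ i, Finsupp.single (w i) 1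
  -- `m w` is the exponent vector of the word, so each coefficient of `F` sums `c` over the words
  -- with the same letter counts, where `T` is constant.
  let F : MvPolynomial J ℂ := ∑ w, MvPolynomial.monomial (m w) (c w)
  have hF : F = 0 := by
    refine MvPolynomial.funext fun z => ?_
    rw [map_zero, ← hc z, map_sum]
    refine Finset.sum_congr rfl fun w _ => ?_
    rw [MvPolynomial.eval_monomial]
    congr 1
    rw [Finsupp.prod_fintype _ _ (by simp)]
    have : ∀ j, z j ^ (m w j) = ∏ i, z j ^ (Finsupp.single (w i) 1 j) := by
      intro j
      rw [Finset.prod_pow_eq_pow_sum]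
      simp [m, Finset.sum_apply]
    rw [Finset.prod_congr rfl fun j _ => this j, Finset.prod_comm]
    refine Finset.prod_congr rfl fun i _ => ?_
    rw [Finset.prod_eq_single (w i)]
    · simp
    · intro j _ hj
      simp [hj.symm]
    · simp
  have hTm : ∀ w w', m w = m w' → T w = T w' := by
    intro w w' h
    obtain ⟨π, hπ⟩ := exists_perm_of_sum_single_eq h
    rw [← hT π w']
    exact congrArg T (funext fun i => (hπ i).symm)
  have key : ∀ k ∈ Finset.univ.image m, ∑ w with m w = k, c w * T w = 0 := by
    intro k hk
    obtain ⟨w₀, -, rfl⟩ := Finset.mem_image.mp hk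
    have h0 : ∑ w with m w = m w₀, c w = 0 := by
      have := congrArg (MvPolynomial.coeff (m w₀)) hF
      simpa [F, MvPolynomial.coeff_sum, MvPolynomial.coeff_monomial, Finset.sum_filter] using this
    calc ∑ w with m w = m w₀, c w * T w = ∑ w with m w = m w₀, c w * T w₀ :=
          Finset.sum_congr rfl fun w hw => by rw [hTm w w₀ (Finset.mem_filter.mp hw).2]
      _ = 0 := by rw [← Finset.sum_mul, h0, zero_mul]
  rw [← Finset.sum_fiberwise_of_maps_to (fun w _ => Finset.mem_image_of_mem m (Finset.mem_univ w))]
  exact Finset.sum_eq_zero key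

lemma linearMap_apply_eq_sum [Fintype ι] [DecidableEq ι]
    (f : Matrix ι ι ℂ →ₗ[ℂ] ℂ) (A : Matrix ι ι ℂ) :
    f A = ∑ x, ∑ y, f (Matrix.single x y 1) * A x y := by
  conv_lhs => rw [Matrix.matrix_eq_sum_single A]
  simp only [map_sum]
  refine Finset.sum_congr rfl fun x _ => Finset.sum_congr rfl fun y _ => ?_
  rw [← mul_one (A x y), ← smul_eq_mul, ← Matrix.smul_single, map_smul, smul_eq_mul, smul_eq_mul,
    mul_one, mul_comm]

/-- Permutation-invariant operators are linear combinations of tensor powers. -/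
theorem IsPermInvariant.mem_span_range_tensorPow [Fintype ι] [DecidableEq ι]
    {T : Matrix (Word n ι) (Word n ι) ℂ} (hT : IsPermInvariant T) :
    T ∈ Submodule.span ℂ (Set.range (tensorPow n : Matrix ι ι ℂ → _)) := by
  by_contra hmem
  -- A functional separating `T` from the span is, on tensor powers `A^{⊗n}`, a homogeneous form in
  -- the entries of `A` that vanishes identically.
  obtain ⟨f, hf, hker⟩ := Submodule.exists_le_ker_of_notMem hmem
  apply hf
  -- Zipping row and column words turns `T` into a tensor over the alphabet `ι × ι`, symmetric by
  -- permutation invariance.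
  let e := Equiv.arrowProdEquivProdArrow (Fin n) (fun _ => ι) (fun _ => ι)
  have hsum : ∀ A : Matrix (Word n ι) (Word n ι) ℂ,
      f A = ∑ w : Fin n → ι × ι, f (Matrix.single (e w).1 (e w).2 1) * A (e w).1 (e w).2 := by
    intro A
    rw [linearMap_apply_eq_sum, ← Fintype.sum_prod_type',
      ← Equiv.sum_comp e]
  rw [hsum]
  refine sum_mul_eq_zero_of_forall_sum_mul_prod_eq_zero _ _ (fun z => ?_) (fun π w => ?_)
  · have h := hker (Submodule.subset_span ⟨Matrix.of fun i j => z (i, j), rfl⟩)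
    rw [LinearMap.mem_ker, hsum] at h
    exact h
  · exact hT.apply_comp π (e w).1 (e w).2

/-- A subspace containing `(∑ⱼ zⱼ Bⱼ)^{⊗n}` for all `z` in a product of infinite sets contains it
for all `z`. -/
lemma tensorPow_sum_smul_mem [Fintype ι] [DecidableEq ι] {J : Type} [Fintype J]
    (S : Submodule ℂ (Matrix (Word n ι) (Word n ι) ℂ)) (B : J → Matrix ι ι ℂ) (s : J → Set ℂ)
    (hs : ∀ j, (s j).Infinite)
    (h : ∀ z ∈ Set.univ.pi s, tensorPow n (∑ j, z j • B j) ∈ S) (z : J → ℂ) :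
    tensorPow n (∑ j, z j • B j) ∈ S := by
  by_contra hmem
  obtain ⟨f, hf, hker⟩ := Submodule.exists_le_ker_of_notMem hmem
  apply hf
  -- A separating functional, evaluated along the family, is a polynomial in `z`; one that vanishes
  -- on a product of infinite sets is zero.
  let F : MvPolynomial J ℂ := ∑ x : Word n ι, ∑ y : Word n ι,
    MvPolynomial.C (f (Matrix.single x y 1)) *
      ∏ i, ∑ j, MvPolynomial.X j * MvPolynomial.C (B j (x i) (y i))
  have hF : ∀ z, f (tensorPow n (∑ j, z j • B j)) = MvPolynomial.eval z F := by
    intro z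
    rw [linearMap_apply_eq_sum]
    simp [F, tensorPow_apply, Matrix.sum_apply]
  have h0 : F = 0 := MvPolynomial.funext_set s hs fun z hz => by
    rw [← hF, map_zero]
    exact hker (h z hz)
  rw [hF, h0, map_zero]

/-- The linear span of the `n`-th tensor powers of unitaries. -/
def unitarySpan (n : ℕ) (ι : Type) [Fintype ι] [DecidableEq ι] : Submodule ℂ (Matrix (Word n ι) (Word n ι) ℂ) :=
  Submodule.span ℂ ((tensorPow n) '' (Matrix.unitaryGroup ι ℂ : Set (Matrix ι ι ℂ)))

lemma mul_mem_unitarySpan [Fintype ι] [DecidableEq ι] {A B : Matrix (Word n ι) (Word n ι) ℂ}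
    (hA : A ∈ unitarySpan n ι) (hB : B ∈ unitarySpan n ι) : A * B ∈ unitarySpan n ι := by
  have h := Submodule.mul_mem_mul hA hB
  rw [unitarySpan, Submodule.span_mul_span] at h
  refine Submodule.span_mono ?_ h
  rintro _ ⟨_, ⟨U, hU, rfl⟩, _, ⟨V, hV, rfl⟩, rfl⟩
  exact ⟨U * V, mul_mem hU hV, tensorPow_mul U V⟩

/-- Diagonal matrices with entries on the unit circle are unitary, and the circle is infinite, so
`tensorPow_sum_smul_mem` extends membership to all diagonal entries. -/
lemma tensorPow_diagonal_mem_unitarySpan [Fintype ι] [DecidableEq ι] (z : ι → ℂ) :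
    tensorPow n (Matrix.diagonal z) ∈ unitarySpan n ι := by
  have hd : ∀ z : ι → ℂ, ∑ j, z j • Matrix.single j j (1 : ℂ) = Matrix.diagonal z := by
    intro z
    ext a b
    simp [Matrix.sum_apply, Matrix.single_apply, Matrix.diagonal_apply, ite_and]
  rw [← hd]
  refine tensorPow_sum_smul_mem _ _ (fun _ => Metric.sphere (0 : ℂ) 1) (fun _ => ?_) ?_ z
  · refine ((Set.Ioc_infinite (zero_lt_one' ℝ)).image (f := fun t => (Circle.exp t : ℂ))
      ?_).mono ?_
    · refine (Circle.coe_injective.injOn (s := Set.univ)).comp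
        (Circle.exp_injOn_Ioc (a := 0) (b := 1) ?_) (Set.mapsTo_univ _ _)
      linarith [Real.pi_gt_three]
    · rintro _ ⟨t, -, rfl⟩
      exact (Circle.exp t).2
  · intro z hz
    rw [hd]
    refine Submodule.subset_span ⟨_, ?_, rfl⟩
    rw [SetLike.mem_coe, Matrix.mem_unitaryGroup_iff, Matrix.star_eq_conjTranspose,
      Matrix.diagonal_conjTranspose, Matrix.diagonal_mul_diagonal, ← Matrix.diagonal_one]
    congr 1
    funext j
    have hj : ‖z j‖ = 1 := by simpa using hz j (Set.mem_univ j)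
    simp [Complex.mul_conj, Complex.normSq_eq_norm_sq, hj]

lemma tensorPow_mem_unitarySpan_of_isHermitian [Fintype ι] [DecidableEq ι] {A : Matrix ι ι ℂ}
    (hA : A.IsHermitian) : tensorPow n A ∈ unitarySpan n ι := by
  rw [hA.spectral_theorem, Unitary.conjStarAlgAut_apply, tensorPow_mul, tensorPow_mul]
  refine mul_mem_unitarySpan (mul_mem_unitarySpan ?_ (tensorPow_diagonal_mem_unitarySpan _)) ?_
  · exact Submodule.subset_span ⟨_, hA.eigenvectorUnitary.2, rfl⟩
  · exact Submodule.subset_span ⟨_, Unitary.star_mem hA.eigenvectorUnitary.2, rfl⟩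

/-- Real combinations of the real and imaginary parts of `A` are Hermitian, hence covered by the
spectral theorem and the diagonal case; polynomial extension from real coefficients then reaches
`(1, i)`, which gives `A`. -/
lemma tensorPow_mem_unitarySpan [Fintype ι] [DecidableEq ι] (A : Matrix ι ι ℂ) :
    tensorPow n A ∈ unitarySpan n ι := by
  have hA := realPart_add_I_smul_imaginaryPart A
  let B : Fin 2 → Matrix ι ι ℂ := ![(realPart A : Matrix ι ι ℂ), (imaginaryPart A : Matrix ι ι ℂ)]
  have key := tensorPow_sum_smul_mem (unitarySpan n ι) B (fun _ => Set.range ((↑) : ℝ → ℂ))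
    (fun _ => Set.infinite_range_of_injective Complex.ofReal_injective) ?_ ![1, Complex.I]
  · simpa [B, hA] using key
  · intro z hz
    obtain ⟨a, ha⟩ := hz 0 (Set.mem_univ _)
    obtain ⟨b, hb⟩ := hz 1 (Set.mem_univ _)
    refine tensorPow_mem_unitarySpan_of_isHermitian ?_
    rw [Fin.sum_univ_two, ← ha, ← hb]
    refine Matrix.IsHermitian.add ?_ ?_
    · have h0 : (realPart A : Matrix ι ι ℂ).IsHermitian := (realPart A).2
      simp [B, Matrix.IsHermitian, Matrix.conjTranspose_smul, h0.eq]
    · have h0 : (imaginaryPart A : Matrix ι ι ℂ).IsHermitian := (imaginaryPart A).2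
      simp [B, Matrix.IsHermitian, Matrix.conjTranspose_smul, h0.eq]

/-- Permutation-invariant operators are linear combinations of tensor powers of unitaries. -/
theorem IsPermInvariant.mem_unitarySpan [Fintype ι] [DecidableEq ι]
    {T : Matrix (Word n ι) (Word n ι) ℂ} (hT : IsPermInvariant T) : T ∈ unitarySpan n ι := by
  refine Submodule.span_le.mpr ?_ hT.mem_span_range_tensorPow
  rintro _ ⟨A, rfl⟩
  exact tensorPow_mem_unitarySpan A

end TensorPow

/-! ### Haar measure on the unitary group. -/

section HaarUnitary

variable {d : ℕ}

instance isProbabilityMeasure_haarUnitary : IsProbabilityMeasure (haarUnitary d) :=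
  ⟨by simpa [haarUnitary] using
    Measure.haarMeasure_self (K₀ := (⊤ : TopologicalSpace.PositiveCompacts
      (Matrix.unitaryGroup (Fin d) ℂ)))⟩

instance isHaarMeasure_haarUnitary : (haarUnitary d).IsHaarMeasure := by
  unfold haarUnitary; infer_instance

/-- A right translate is again a left Haar probability measure, so uniqueness applies. -/
instance isMulRightInvariant_haarUnitary : (haarUnitary d).IsMulRightInvariant := by
  refine ⟨fun V => ?_⟩
  have : IsProbabilityMeasure ((haarUnitary d).map (· * V)) :=
    Measure.isProbabilityMeasure_map (measurable_mul_const V).aemeasurable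
  exact Measure.isHaarMeasure_eq_of_isProbabilityMeasure _ _

instance secondCountableTopology_unitaryGroup :
    SecondCountableTopology (Matrix.unitaryGroup (Fin d) ℂ) := by
  have : SecondCountableTopology (Matrix (Fin d) (Fin d) ℂ) := inferInstance
  exact TopologicalSpace.Subtype.secondCountableTopology _

lemma integrable_of_continuous {E : Type*} [NormedAddCommGroup E]
    {f : Matrix.unitaryGroup (Fin d) ℂ → E} (hf : Continuous f) :
    Integrable f (haarUnitary d) :=
  hf.integrable_of_hasCompactSupport (HasCompactSupport.of_compactSpace f)

lemma integral_linearMap_comp {E F : Type*} [NormedAddCommGroup E] [NormedSpace ℂ E]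
    [FiniteDimensional ℂ E] [NormedAddCommGroup F] [NormedSpace ℂ F] [CompleteSpace F]
    (L : E →ₗ[ℂ] F) {f : Matrix.unitaryGroup (Fin d) ℂ → E} (hf : Continuous f) :
    ∫ U, L (f U) ∂(haarUnitary d) = L (∫ U, f U ∂(haarUnitary d)) := by
  have : CompleteSpace E := FiniteDimensional.complete ℂ E
  exact (LinearMap.toContinuousLinearMap L).integral_comp_comm (integrable_of_continuous hf)

end HaarUnitary

/-! ### The maximally entangled vector and the transpose trick. -/

section Vectors

variable {ι κ : Type} [Fintype ι] [DecidableEq ι] [Fintype κ]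

lemma proj_mulVec (A : Matrix κ κ ℂ) (v : κ → ℂ) :
    proj (A.mulVec v) = A * proj v * A.conjTranspose := by
  rw [proj, proj, Matrix.mul_vecMulVec, Matrix.vecMulVec_mul, Matrix.star_mulVec]

/-- Paired with `one_kronecker_mulVec_maxEnt`, this is the transpose trick: `A ⊗ I` and `I ⊗ Aᵀ`
agree on the maximally entangled vector. -/
lemma kronecker_one_mulVec_maxEnt (A : Matrix ι ι ℂ) :
    (A ⊗ₖ (1 : Matrix ι ι ℂ)).mulVec (maxEnt ι) = fun p => A p.1 p.2 := by
  funext ⟨x, z⟩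
  simp [Matrix.mulVec, dotProduct, Fintype.sum_prod_type, maxEnt, Matrix.one_apply]

lemma one_kronecker_mulVec_maxEnt (A : Matrix ι ι ℂ) :
    ((1 : Matrix ι ι ℂ) ⊗ₖ A).mulVec (maxEnt ι) = fun p => A p.2 p.1 := by
  funext ⟨x, z⟩
  simp [Matrix.mulVec, dotProduct, Fintype.sum_prod_type, maxEnt, Matrix.one_apply]

lemma one_kronecker_mulVec_apply (A : Matrix κ κ ℂ) (v : ι × κ → ℂ) (x : ι) (z : κ) :
    ((1 : Matrix ι ι ℂ) ⊗ₖ A).mulVec v (x, z) = ∑ w, A z w * v (x, w) := by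
  simp [Matrix.mulVec, dotProduct, Fintype.sum_prod_type, Matrix.one_apply]

lemma stdPurification_eq (ρ : Matrix ι ι ℂ) :
    stdPurification ρ = fun p => CFC.sqrt ρ p.1 p.2 :=
  kronecker_one_mulVec_maxEnt _

end Vectors

/-! ### The twirled maximally entangled operator and its symmetries. -/

section Twirl

variable {n d : ℕ}

/-- The local unitary `I ⊗ U^{⊗n}`. -/
def rightRot (n : ℕ) {d : ℕ} (U : Matrix (Fin d) (Fin d) ℂ) :
    Matrix (Word n (Fin d) × Word n (Fin d)) (Word n (Fin d) × Word n (Fin d)) ℂ :=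
  (1 : Matrix (Word n (Fin d)) (Word n (Fin d)) ℂ) ⊗ₖ tensorPow n U

lemma rightRot_mul (U V : Matrix (Fin d) (Fin d) ℂ) :
    rightRot n (U * V) = rightRot n U * rightRot n V := by
  rw [rightRot, rightRot, rightRot, tensorPow_mul, ← Matrix.mul_kronecker_mul, one_mul]

lemma rightRot_conjTranspose (U : Matrix (Fin d) (Fin d) ℂ) :
    rightRot n U.conjTranspose = (rightRot n U).conjTranspose := by
  rw [rightRot, rightRot, tensorPow_conjTranspose, Matrix.conjTranspose_kronecker,
    Matrix.conjTranspose_one]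

lemma kronecker_one_mul_rightRot (A : Matrix (Word n (Fin d)) (Word n (Fin d)) ℂ)
    (U : Matrix (Fin d) (Fin d) ℂ) :
    (A ⊗ₖ (1 : Matrix (Word n (Fin d)) (Word n (Fin d)) ℂ)) * rightRot n U =
      rightRot n U * (A ⊗ₖ 1) := by
  rw [rightRot, ← Matrix.mul_kronecker_mul, ← Matrix.mul_kronecker_mul, one_mul, one_mul, mul_one,
    mul_one]

/-- The maximally entangled operator, rotated on the second half. -/
def rotatedMaxEnt (n : ℕ) {d : ℕ} (U : Matrix (Fin d) (Fin d) ℂ) :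
    Matrix (Word n (Fin d) × Word n (Fin d)) (Word n (Fin d) × Word n (Fin d)) ℂ :=
  rightRot n U * proj (maxEnt (Word n (Fin d))) * (rightRot n U).conjTranspose

lemma continuous_rightRot :
    Continuous fun U : Matrix.unitaryGroup (Fin d) ℂ => rightRot n (U : Matrix (Fin d) (Fin d) ℂ) := by
  refine continuous_matrix fun p q => ?_
  simp only [rightRot, Matrix.kroneckerMap_apply, tensorPow_apply]
  exact continuous_const.mul (continuous_finsetProd _ fun i _ =>
    (continuous_subtype_val).matrix_elem _ _)

lemma continuous_rotatedMaxEnt :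
    Continuous fun U : Matrix.unitaryGroup (Fin d) ℂ =>
      rotatedMaxEnt n (U : Matrix (Fin d) (Fin d) ℂ) :=
  (continuous_rightRot.matrix_mul continuous_const).matrix_mul
    continuous_rightRot.matrix_conjTranspose

/-- Operators on different halves commute, so `√ρ` can be pulled outside the rotation and later
outside the Haar average. -/
lemma rotatedStd_eq (ρ : Matrix (Word n (Fin d)) (Word n (Fin d)) ℂ)
    (U : Matrix.unitaryGroup (Fin d) ℂ) :
    rotatedStd ρ U = (CFC.sqrt ρ ⊗ₖ (1 : Matrix (Word n (Fin d)) (Word n (Fin d)) ℂ)) *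
      rotatedMaxEnt n (U : Matrix (Fin d) (Fin d) ℂ) *
      (CFC.sqrt ρ ⊗ₖ (1 : Matrix (Word n (Fin d)) (Word n (Fin d)) ℂ)) := by
  have hsa : (CFC.sqrt ρ).conjTranspose = CFC.sqrt ρ :=
    (CFC.sqrt_nonneg ρ).isSelfAdjoint
  have h1 := kronecker_one_mul_rightRot (CFC.sqrt ρ) (U : Matrix (Fin d) (Fin d) ℂ)
  have h2 := kronecker_one_mul_rightRot (CFC.sqrt ρ) (U : Matrix (Fin d) (Fin d) ℂ).conjTranspose
  rw [rightRot_conjTranspose] at h2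
  have h0 : rotatedStd ρ U = rightRot n (U : Matrix (Fin d) (Fin d) ℂ) *
    proj (stdPurification ρ) * rightRot n (U : Matrix (Fin d) (Fin d) ℂ).conjTranspose := rfl
  rw [h0, stdPurification, proj_mulVec, rotatedMaxEnt, Matrix.conjTranspose_kronecker, hsa,
    Matrix.conjTranspose_one, rightRot_conjTranspose]
  simp only [Matrix.mul_assoc]
  rw [h2]
  simp only [← Matrix.mul_assoc]
  rw [h1]

/-- The Haar twirl of the maximally entangled operator. -/
noncomputable def twirl (n d : ℕ) :
    Matrix (Word n (Fin d) × Word n (Fin d)) (Word n (Fin d) × Word n (Fin d)) ℂ :=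
  ∫ U, rotatedMaxEnt n (U : Matrix (Fin d) (Fin d) ℂ) ∂(haarUnitary d)

lemma map_twirl {F : Type*} [NormedAddCommGroup F] [NormedSpace ℂ F] [CompleteSpace F]
    (L : Matrix (Word n (Fin d) × Word n (Fin d)) (Word n (Fin d) × Word n (Fin d)) ℂ →ₗ[ℂ] F) :
    L (twirl n d) = ∫ U, L (rotatedMaxEnt n (U : Matrix (Fin d) (Fin d) ℂ)) ∂(haarUnitary d) :=
  (integral_linearMap_comp L continuous_rotatedMaxEnt).symm

lemma mul_twirl_mul (A B : Matrix (Word n (Fin d) × Word n (Fin d))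
    (Word n (Fin d) × Word n (Fin d)) ℂ) :
    A * twirl n d * B =
      ∫ U, A * rotatedMaxEnt n (U : Matrix (Fin d) (Fin d) ℂ) * B ∂(haarUnitary d) :=
  map_twirl ((LinearMap.mulRight ℂ B).comp (LinearMap.mulLeft ℂ A))

lemma twirl_nonneg : 0 ≤ twirl n d := by
  refine integral_nonneg fun U => ?_
  rw [Pi.zero_apply, Matrix.nonneg_iff_posSemidef, rotatedMaxEnt]
  exact (Matrix.posSemidef_vecMulVec_self_star _).mul_mul_conjTranspose_same _

/-- Conjugating by `V^{⊗n} ⊗ I` replaces `U` by `U Vᵀ` under the integral, by the transpose trick;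
right invariance undoes this since `Vᵀ` is unitary. -/
lemma twirl_commute_unitary (V : Matrix.unitaryGroup (Fin d) ℂ) :
    Commute (twirl n d) (tensorPow n (V : Matrix (Fin d) (Fin d) ℂ) ⊗ₖ
      (1 : Matrix (Word n (Fin d)) (Word n (Fin d)) ℂ)) := by
  set A := tensorPow n (V : Matrix (Fin d) (Fin d) ℂ) ⊗ₖ
      (1 : Matrix (Word n (Fin d)) (Word n (Fin d)) ℂ) with hA
  have hVT : (V : Matrix (Fin d) (Fin d) ℂ).transpose ∈ Matrix.unitaryGroup (Fin d) ℂ := by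
    have h := congrArg Matrix.transpose (Matrix.mem_unitaryGroup_iff'.mp V.2)
    rw [Matrix.transpose_mul, Matrix.transpose_one] at h
    exact Matrix.mem_unitaryGroup_iff.mpr h
  have hAA : A.conjTranspose * A = 1 := by
    rw [hA, Matrix.conjTranspose_kronecker, ← Matrix.mul_kronecker_mul, ← tensorPow_conjTranspose,
      ← tensorPow_mul, ← Matrix.star_eq_conjTranspose, Matrix.mem_unitaryGroup_iff'.mp V.2,
      tensorPow_one, Matrix.conjTranspose_one, one_mul, Matrix.one_kronecker_one]
  have hΩ : A.mulVec (maxEnt (Word n (Fin d))) =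
      (rightRot n (V : Matrix (Fin d) (Fin d) ℂ).transpose).mulVec (maxEnt (Word n (Fin d))) := by
    rw [hA, kronecker_one_mulVec_maxEnt, rightRot, one_kronecker_mulVec_maxEnt]
    rfl
  have hconj : A * twirl n d * A.conjTranspose = twirl n d := by
    rw [mul_twirl_mul, twirl,
      ← integral_mul_right_eq_self (μ := haarUnitary d)
        (fun U => rotatedMaxEnt n (U : Matrix (Fin d) (Fin d) ℂ))
        (⟨_, hVT⟩ : Matrix.unitaryGroup (Fin d) ℂ)]
    congr 1
    funext U
    have h1 := kronecker_one_mul_rightRot (tensorPow n (V : Matrix (Fin d) (Fin d) ℂ))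
      (U : Matrix (Fin d) (Fin d) ℂ)
    rw [← hA] at h1
    rw [rotatedMaxEnt, rotatedMaxEnt, ← proj_mulVec, ← proj_mulVec, ← proj_mulVec,
      Matrix.mulVec_mulVec, h1, ← Matrix.mulVec_mulVec, hΩ, Matrix.mulVec_mulVec, ← rightRot_mul]
    rfl
  have := congrArg (· * A) hconj
  simp only [Matrix.mul_assoc, hAA, mul_one] at this
  exact this.symm

lemma twirl_commute {T : Matrix (Word n (Fin d)) (Word n (Fin d)) ℂ} (hT : IsPermInvariant T) :
    Commute (twirl n d) (T ⊗ₖ (1 : Matrix (Word n (Fin d)) (Word n (Fin d)) ℂ)) := by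
  refine Submodule.span_induction (p := fun T _ => Commute (twirl n d)
    (T ⊗ₖ (1 : Matrix (Word n (Fin d)) (Word n (Fin d)) ℂ))) ?_ ?_ ?_ ?_ hT.mem_unitarySpan
  · rintro _ ⟨V, hV, rfl⟩
    exact twirl_commute_unitary ⟨V, hV⟩
  · rw [Matrix.zero_kronecker]; exact Commute.zero_right _
  · intro x y _ _ hx hy
    rw [Matrix.add_kronecker]; exact hx.add_right hy
  · intro c x _ hx
    rw [Matrix.smul_kronecker]; exact hx.smul_right c

/-- This says `tr₂ T = I`: under the trace each rotation cancels against its adjoint, leaving `⟨Ω| X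
⊗ I |Ω⟩ = tr X`. -/
lemma trace_twirl_mul (X : Matrix (Word n (Fin d)) (Word n (Fin d)) ℂ) :
    (twirl n d * (X ⊗ₖ (1 : Matrix (Word n (Fin d)) (Word n (Fin d)) ℂ))).trace = X.trace := by
  have h := map_twirl (n := n) (d := d) ((Matrix.traceLinearMap _ ℂ ℂ).comp
    (LinearMap.mulRight ℂ (X ⊗ₖ (1 : Matrix (Word n (Fin d)) (Word n (Fin d)) ℂ))))
  simp only [LinearMap.comp_apply, LinearMap.mulRight_apply, Matrix.traceLinearMap_apply] at h
  rw [h]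
  have hU : ∀ U : Matrix.unitaryGroup (Fin d) ℂ,
      (rotatedMaxEnt n (U : Matrix (Fin d) (Fin d) ℂ) *
        (X ⊗ₖ (1 : Matrix (Word n (Fin d)) (Word n (Fin d)) ℂ))).trace = X.trace := by
    intro U
    rw [rotatedMaxEnt, Matrix.mul_assoc, ← rightRot_conjTranspose, ← kronecker_one_mul_rightRot,
      Matrix.trace_mul_comm, Matrix.mul_assoc, ← Matrix.mul_assoc (rightRot n _) (rightRot n _),
      ← rightRot_mul, ← Matrix.star_eq_conjTranspose, Matrix.mem_unitaryGroup_iff'.mp U.2,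
      rightRot, tensorPow_one, Matrix.one_kronecker_one, one_mul, proj, Matrix.mul_vecMulVec,
      kronecker_one_mulVec_maxEnt, Matrix.trace_vecMulVec]
    simp [dotProduct, Fintype.sum_prod_type, maxEnt, Matrix.trace]
  simp [hU]

lemma permOp_mul_transpose {ι : Type} [Fintype ι] [DecidableEq ι] (π : Equiv.Perm (Fin n)) :
    (permOp π : Matrix (Word n ι) (Word n ι) ℂ) * (permOp π).transpose = 1 := by
  ext x y
  rw [permOp_mul_apply, Matrix.transpose_apply, permOp, Matrix.of_apply, Matrix.one_apply]
  simp [eq_comm]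

/-- The transpose trick applies because `R_π` is real orthogonal: `R_π ⊗ R_π` acts as `I ⊗ R_π
R_πᵀ`. -/
lemma permOp_kronecker_permOp_mulVec_maxEnt {ι : Type} [Fintype ι] [DecidableEq ι]
    (π : Equiv.Perm (Fin n)) :
    ((permOp π : Matrix (Word n ι) (Word n ι) ℂ) ⊗ₖ
      (permOp π : Matrix (Word n ι) (Word n ι) ℂ)).mulVec (maxEnt (Word n ι)) =
      maxEnt (Word n ι) := by
  have h1 : (permOp π : Matrix (Word n ι) (Word n ι) ℂ) ⊗ₖ
      (permOp π : Matrix (Word n ι) (Word n ι) ℂ) =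
      ((1 : Matrix (Word n ι) (Word n ι) ℂ) ⊗ₖ permOp π) *
      (permOp π ⊗ₖ (1 : Matrix (Word n ι) (Word n ι) ℂ)) := by
    rw [← Matrix.mul_kronecker_mul, one_mul, mul_one]
  have h2 : ((permOp π : Matrix (Word n ι) (Word n ι) ℂ) ⊗ₖ
      (1 : Matrix (Word n ι) (Word n ι) ℂ)).mulVec (maxEnt (Word n ι)) =
      ((1 : Matrix (Word n ι) (Word n ι) ℂ) ⊗ₖ (permOp π).transpose).mulVec
        (maxEnt (Word n ι)) := by
    rw [kronecker_one_mulVec_maxEnt, one_kronecker_mulVec_maxEnt]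
    rfl
  rw [h1, ← Matrix.mulVec_mulVec, h2, Matrix.mulVec_mulVec, ← Matrix.mul_kronecker_mul, one_mul,
    permOp_mul_transpose, Matrix.one_kronecker_one, Matrix.one_mulVec]

lemma permOp_kronecker_permOp_mul_twirl (π : Equiv.Perm (Fin n)) :
    ((permOp π : Matrix (Word n (Fin d)) (Word n (Fin d)) ℂ) ⊗ₖ
      (permOp π : Matrix (Word n (Fin d)) (Word n (Fin d)) ℂ)) * twirl n d = twirl n d := by
  obtain ⟨R, hR⟩ : ∃ R, R = (permOp π : Matrix (Word n (Fin d)) (Word n (Fin d)) ℂ) ⊗ₖ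
      (permOp π : Matrix (Word n (Fin d)) (Word n (Fin d)) ℂ) := ⟨_, rfl⟩
  rw [← hR]
  have hcomm : ∀ U : Matrix (Fin d) (Fin d) ℂ, R * rightRot n U = rightRot n U * R := by
    intro U
    rw [hR, rightRot, ← Matrix.mul_kronecker_mul, ← Matrix.mul_kronecker_mul,
      isPermInvariant_tensorPow U π, one_mul, mul_one]
  have hfix : R * proj (maxEnt (Word n (Fin d))) = proj (maxEnt (Word n (Fin d))) := by
    rw [proj, Matrix.mul_vecMulVec, hR, permOp_kronecker_permOp_mulVec_maxEnt]
  have h := mul_twirl_mul R 1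
  rw [mul_one] at h
  rw [h, twirl]
  refine integral_congr_ae (Filter.Eventually.of_forall fun U => ?_)
  dsimp only
  rw [mul_one, rotatedMaxEnt, ← Matrix.mul_assoc, ← Matrix.mul_assoc, hcomm,
    Matrix.mul_assoc _ R, hfix]

end Twirl

/-! ### The channel and its values on permutation-invariant states. -/

section Channel

/-- A star homomorphism followed by conjugation is completely positive. -/
noncomputable def conjCP {A B : Type*} [CStarAlgebra A] [CStarAlgebra B] [PartialOrder A]
    [PartialOrder B] [StarOrderedRing A] [StarOrderedRing B] (θ : A →⋆ₙₐ[ℂ] B) (s : B) :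
    A →CP B where
  toLinearMap := (LinearMap.mulRight ℂ s).comp ((LinearMap.mulLeft ℂ (star s)).comp
    (θ : A →ₗ[ℂ] B))
  map_cstarMatrix_nonneg' k M hM := by
    -- Conjugating by the diagonal amplification of `s` conjugates every entry by `s`.
    let D : CStarMatrix (Fin k) (Fin k) B := CStarMatrix.ofMatrix (Matrix.diagonal fun _ => s)
    have h1 : 0 ≤ M.map θ :=
      CompletelyPositiveMapClass.map_cstarMatrix_nonneg' θ k M hM
    have h2 := star_left_conjugate_nonneg h1 D
    convert h2 using 1
    refine CStarMatrix.ext fun i j => ?_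
    rw [CStarMatrix.mul_apply, Finset.sum_eq_single j, CStarMatrix.mul_apply,
      Finset.sum_eq_single i]
    · simp [D, CStarMatrix.star_apply]
    · intro l _ hl
      simp [D, CStarMatrix.star_apply, Matrix.diagonal_apply_ne _ hl]
    · simp
    · intro l _ hl
      simp [D, Matrix.diagonal_apply_ne _ hl]
    · simp

lemma conjCP_apply {A B : Type*} [CStarAlgebra A] [CStarAlgebra B] [PartialOrder A]
    [PartialOrder B] [StarOrderedRing A] [StarOrderedRing B] (θ : A →⋆ₙₐ[ℂ] B) (s : B) (x : A) :
    conjCP θ s x = star s * θ x * s := rfl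

variable {n d : ℕ}

lemma regroup_mul {ι : Type} [Fintype ι] [DecidableEq ι]
    (A B : Matrix (Word n ι × Word n ι) (Word n ι × Word n ι) ℂ) :
    regroup (A * B) = regroup A * regroup B :=
  (Matrix.submatrix_mul_equiv A B _ (Equiv.arrowProdEquivProdArrow (Fin n) (fun _ => ι)
    (fun _ => ι)) _).symm

lemma trace_regroup {ι : Type} [Fintype ι] [DecidableEq ι]
    (A : Matrix (Word n ι × Word n ι) (Word n ι × Word n ι) ℂ) :
    (regroup A).trace = A.trace :=
  Equiv.sum_comp (Equiv.arrowProdEquivProdArrow (Fin n) (fun _ => ι) (fun _ => ι))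
    (fun p => A p p)

lemma regroup_permOp_kronecker_permOp {ι : Type} [Fintype ι] [DecidableEq ι]
    (π : Equiv.Perm (Fin n)) :
    regroup ((permOp π : Matrix (Word n ι) (Word n ι) ℂ) ⊗ₖ
      (permOp π : Matrix (Word n ι) (Word n ι) ℂ)) = permOp π := by
  ext x y
  simp only [regroup, Matrix.submatrix_apply, Matrix.kroneckerMap_apply, permOp, Matrix.of_apply,
    funext_iff, Prod.ext_iff, forall_and, mul_ite, mul_one, mul_zero]
  rw [ite_and]
  split_ifs <;> rfl

/-- The reordering of tensor factors as a linear map. -/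
def regroupLinearMap (n : ℕ) (ι : Type) :
    Matrix (Word n ι × Word n ι) (Word n ι × Word n ι) ℂ →ₗ[ℂ]
      Matrix (Word n (ι × ι)) (Word n (ι × ι)) ℂ where
  toFun := regroup
  map_add' _ _ := rfl
  map_smul' _ _ := rfl

/-- The embedding `X ↦ X ⊗ I`, as operators on `(ℂ^ι ⊗ ℂ^ι)^{⊗n}`. -/
def leftEmbedding (n : ℕ) (ι : Type) [Fintype ι] [DecidableEq ι] :
    Matrix (Word n ι) (Word n ι) ℂ →⋆ₙₐ[ℂ] Matrix (Word n (ι × ι)) (Word n (ι × ι)) ℂ where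
  toFun X := regroup (X ⊗ₖ (1 : Matrix (Word n ι) (Word n ι) ℂ))
  map_smul' c X := by rw [Matrix.smul_kronecker]; rfl
  map_zero' := by rw [Matrix.zero_kronecker]; rfl
  map_add' X Y := by rw [Matrix.add_kronecker]; rfl
  map_mul' X Y := by rw [← regroup_mul, ← Matrix.mul_kronecker_mul, one_mul]
  map_star' X := by
    rw [Matrix.star_eq_conjTranspose, ← Matrix.conjTranspose_one, ← Matrix.conjTranspose_kronecker,
      Matrix.conjTranspose_one]
    rfl

/-- The random purification channel. -/
noncomputable def purifyChannel (n d : ℕ) :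
    Matrix (Word n (Fin d)) (Word n (Fin d)) ℂ →CP
      Matrix (Word n (Fin d × Fin d)) (Word n (Fin d × Fin d)) ℂ :=
  conjCP (leftEmbedding n (Fin d)) (regroup (CFC.sqrt (twirl n d)))

lemma conjTranspose_sqrt_twirl :
    (CFC.sqrt (twirl n d)).conjTranspose = CFC.sqrt (twirl n d) :=
  (CFC.sqrt_nonneg (twirl n d)).isSelfAdjoint

lemma sqrt_twirl_mul_self : CFC.sqrt (twirl n d) * CFC.sqrt (twirl n d) = twirl n d :=
  CFC.sqrt_mul_sqrt_self _ twirl_nonneg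

lemma purifyChannel_apply (X : Matrix (Word n (Fin d)) (Word n (Fin d)) ℂ) :
    purifyChannel n d X = regroup (CFC.sqrt (twirl n d) *
      (X ⊗ₖ (1 : Matrix (Word n (Fin d)) (Word n (Fin d)) ℂ)) * CFC.sqrt (twirl n d)) := by
  have h : star (regroup (CFC.sqrt (twirl n d))) = regroup (CFC.sqrt (twirl n d)) :=
    congrArg regroup conjTranspose_sqrt_twirl
  rw [purifyChannel, conjCP_apply, h, regroup_mul, regroup_mul]
  rfl

lemma trace_purifyChannel (X : Matrix (Word n (Fin d)) (Word n (Fin d)) ℂ) :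
    (purifyChannel n d X).trace = X.trace := by
  rw [purifyChannel_apply, trace_regroup, Matrix.trace_mul_comm, ← Matrix.mul_assoc,
    sqrt_twirl_mul_self, trace_twirl_mul]

/-- With `S = √T`, expanding `(RS - S)(RS - S)†` leaves only products of `R`, `R†` and `S² = T`,
which cancel once `RT = T`. -/
lemma permOp_kronecker_permOp_mul_sqrt_twirl (π : Equiv.Perm (Fin n)) :
    ((permOp π : Matrix (Word n (Fin d)) (Word n (Fin d)) ℂ) ⊗ₖ
      (permOp π : Matrix (Word n (Fin d)) (Word n (Fin d)) ℂ)) * CFC.sqrt (twirl n d) =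
      CFC.sqrt (twirl n d) := by
  have h := permOp_kronecker_permOp_mul_twirl (d := d) π
  obtain ⟨R, hR⟩ : ∃ R, R = (permOp π : Matrix (Word n (Fin d)) (Word n (Fin d)) ℂ) ⊗ₖ
      (permOp π : Matrix (Word n (Fin d)) (Word n (Fin d)) ℂ) := ⟨_, rfl⟩
  rw [← hR] at h ⊢
  have h0 : (R * CFC.sqrt (twirl n d) - CFC.sqrt (twirl n d)) *
      (R * CFC.sqrt (twirl n d) - CFC.sqrt (twirl n d)).conjTranspose = 0 := by
    rw [Matrix.conjTranspose_sub, Matrix.conjTranspose_mul, conjTranspose_sqrt_twirl,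
      mul_sub, sub_mul, ← Matrix.mul_assoc, Matrix.mul_assoc R, sqrt_twirl_mul_self, h,
      sub_mul, ← Matrix.mul_assoc, Matrix.mul_assoc R, sqrt_twirl_mul_self, h]
    simp
  exact sub_eq_zero.mp (Matrix.self_mul_conjTranspose_eq_zero.mp h0)

lemma permOp_mul_purifyChannel (π : Equiv.Perm (Fin n))
    (X : Matrix (Word n (Fin d)) (Word n (Fin d)) ℂ) :
    permOp π * purifyChannel n d X = purifyChannel n d X := by
  rw [purifyChannel_apply, ← regroup_permOp_kronecker_permOp, ← regroup_mul, ← Matrix.mul_assoc,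
    ← Matrix.mul_assoc, permOp_kronecker_permOp_mul_sqrt_twirl]

lemma conjTranspose_purifyChannel (X : Matrix (Word n (Fin d)) (Word n (Fin d)) ℂ) :
    (purifyChannel n d X).conjTranspose = purifyChannel n d X.conjTranspose := by
  have h : ∀ Y : Matrix (Word n (Fin d)) (Word n (Fin d)) ℂ,
      purifyChannel n d Y = star (regroup (CFC.sqrt (twirl n d))) * leftEmbedding n (Fin d) Y *
        regroup (CFC.sqrt (twirl n d)) := fun Y => rfl
  rw [h, h, ← Matrix.star_eq_conjTranspose, ← Matrix.star_eq_conjTranspose, map_star, star_mul,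
    star_mul, star_star, mul_assoc]

lemma supportedOn_purifyChannel (X : Matrix (Word n (Fin d)) (Word n (Fin d)) ℂ) :
    SupportedOn (symSubspace n (Fin d × Fin d)) (purifyChannel n d X) := by
  refine ⟨fun v π => ?_, fun v π => ?_⟩
  · rw [Matrix.mulVec_mulVec, permOp_mul_purifyChannel]
  · rw [conjTranspose_purifyChannel, Matrix.mulVec_mulVec, permOp_mul_purifyChannel]

/-- Both square roots inherit the commutation relations through functional calculus, so `√T` and `√ρ
⊗ I` commute and the roles of `T` and `ρ ⊗ I` can be exchanged. -/
lemma purifyChannel_of_isPermInvariant {ρ : Matrix (Word n (Fin d)) (Word n (Fin d)) ℂ}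
    (hρ : ρ.PosSemidef) (hinv : IsPermInvariant ρ) :
    purifyChannel n d ρ = ∫ U, regroup (rotatedStd ρ U) ∂(haarUnitary d) := by
  have hsqrt : IsPermInvariant (CFC.sqrt ρ) := fun π =>
    (Commute.cfcₙ_nnreal (show Commute ρ (permOp π) from (hinv π).symm) NNReal.sqrt).symm
  have hcomm := Commute.cfcₙ_nnreal (twirl_commute hsqrt) NNReal.sqrt
  change CFC.sqrt (twirl n d) * _ = _ * CFC.sqrt (twirl n d) at hcomm
  have hρρ : ρ ⊗ₖ (1 : Matrix (Word n (Fin d)) (Word n (Fin d)) ℂ) =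
      (CFC.sqrt ρ ⊗ₖ (1 : Matrix (Word n (Fin d)) (Word n (Fin d)) ℂ)) *
      (CFC.sqrt ρ ⊗ₖ (1 : Matrix (Word n (Fin d)) (Word n (Fin d)) ℂ)) := by
    rw [← Matrix.mul_kronecker_mul, one_mul,
      CFC.sqrt_mul_sqrt_self ρ (Matrix.nonneg_iff_posSemidef.mpr hρ)]
  have hint := map_twirl (n := n) (d := d) ((regroupLinearMap n (Fin d)).comp
    ((LinearMap.mulRight ℂ (CFC.sqrt ρ ⊗ₖ (1 : Matrix (Word n (Fin d)) (Word n (Fin d)) ℂ))).comp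
      (LinearMap.mulLeft ℂ (CFC.sqrt ρ ⊗ₖ (1 : Matrix (Word n (Fin d)) (Word n (Fin d)) ℂ)))))
  rw [purifyChannel_apply, hρρ]
  calc _ = regroup ((CFC.sqrt ρ ⊗ₖ (1 : Matrix (Word n (Fin d)) (Word n (Fin d)) ℂ)) *
        twirl n d * (CFC.sqrt ρ ⊗ₖ (1 : Matrix (Word n (Fin d)) (Word n (Fin d)) ℂ))) := by
        refine congrArg regroup ?_
        rw [← Matrix.mul_assoc, Matrix.mul_assoc, ← hcomm]
        nth_rw 1 [hcomm]
        rw [Matrix.mul_assoc,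
          ← Matrix.mul_assoc (CFC.sqrt (twirl n d)), sqrt_twirl_mul_self, Matrix.mul_assoc]
    _ = _ := hint
    _ = _ := by
      refine integral_congr_ae (Filter.Eventually.of_forall fun U => ?_)
      dsimp only
      rw [rotatedStd_eq]
      rfl

end Channel

/-! ### Transitivity of the unitary action on purifications. -/

section Gram

variable {d : ℕ}

/-- Two families of vectors with the same Gram matrix differ by a linear isometry. -/
lemma exists_linearIsometry_of_inner_eq {V : Type*} [NormedAddCommGroup V] [InnerProductSpace ℂ V]
    [FiniteDimensional ℂ V] {ι : Type*} [Fintype ι] (v w : ι → V)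
    (h : ∀ i j, inner ℂ (v i) (v j) = inner ℂ (w i) (w j)) :
    ∃ L : V →ₗᵢ[ℂ] V, ∀ i, L (v i) = w i := by
  classical
  let T := Fintype.linearCombination ℂ v
  let T' := Fintype.linearCombination ℂ w
  have hnorm : ∀ c, ‖T' c‖ = ‖T c‖ := by
    intro c
    have : inner ℂ (T' c) (T' c) = inner ℂ (T c) (T c) := by
      simp only [T, T', Fintype.linearCombination_apply, sum_inner, inner_sum, inner_smul_left,
        inner_smul_right, h]
    rw [@norm_eq_sqrt_re_inner ℂ, @norm_eq_sqrt_re_inner ℂ, this]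
  -- `T' ∘ g` is isometric on the span of `v`, by equality of norms, and finite dimension allows
  -- extending it to `V`.
  obtain ⟨g, hg⟩ := T.rangeRestrict.exists_rightInverse_of_surjective
    (LinearMap.range_rangeRestrict T)
  have hg' : ∀ s : LinearMap.range T, T (g s) = s := fun s =>
    congrArg Subtype.val (LinearMap.congr_fun hg s)
  let L : LinearMap.range T →ₗᵢ[ℂ] V :=
    ⟨T'.comp g, fun s => by
      rw [LinearMap.comp_apply, hnorm, hg']
      rfl⟩
  refine ⟨L.extend, fun i => ?_⟩
  have hv : T (Pi.single i 1) = v i := by simp [T]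
  have hw : T' (Pi.single i 1) = w i := by simp [T']
  have h1 := L.extend_apply ⟨T (Pi.single i 1), LinearMap.mem_range_self _ _⟩
  rw [← hv, ← hw, h1]
  change T' (g _) = _
  -- The chosen preimage differs from the basis vector by an element of `ker T`, which `T'` kills
  -- because norms agree.
  rw [← sub_eq_zero, ← map_sub, ← norm_eq_zero, hnorm, map_sub, hg', sub_self, norm_zero]

/-- The unitary group acts transitively on the purifications of an operator. -/
lemma exists_unitary_mulVec_eq {ψ φ : Fin d × Fin d → ℂ}
    (h : partialTrace (proj ψ) = partialTrace (proj φ)) :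
    ∃ U : Matrix.unitaryGroup (Fin d) ℂ,
      ((1 : Matrix (Fin d) (Fin d) ℂ) ⊗ₖ (U : Matrix (Fin d) (Fin d) ℂ)).mulVec ψ = φ := by
  let v : Fin d → EuclideanSpace ℂ (Fin d) := fun x => WithLp.toLp 2 fun z => ψ (x, z)
  let w : Fin d → EuclideanSpace ℂ (Fin d) := fun x => WithLp.toLp 2 fun z => φ (x, z)
  obtain ⟨L, hL⟩ := exists_linearIsometry_of_inner_eq v w fun x y => by
    -- The partial trace is the Gram matrix of the rows; the indices are swapped because `inner` is
    -- conjugate-linear in its first argument.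
    have := congrFun (congrFun h y) x
    simpa [partialTrace, proj, Matrix.vecMulVec_apply, v, w, PiLp.inner_apply] using this
  let A : Matrix (Fin d) (Fin d) ℂ := Matrix.of fun i j => L (EuclideanSpace.single j 1) i
  have hA : ∀ u : EuclideanSpace ℂ (Fin d), ∀ i, L u i = ∑ j, A i j * u j := by
    intro u i
    conv_lhs => rw [← (EuclideanSpace.basisFun (Fin d) ℂ).sum_repr u]
    simp [A, mul_comm]
  have hU : A ∈ Matrix.unitaryGroup (Fin d) ℂ := by
    rw [Matrix.mem_unitaryGroup_iff']
    ext i j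
    have := L.inner_map_map (EuclideanSpace.single i 1) (EuclideanSpace.single j 1)
    rw [PiLp.inner_apply] at this
    rw [orthonormal_iff_ite.mp (EuclideanSpace.orthonormal_single (𝕜 := ℂ) (ι := Fin d)) i j] at this
    simpa [Matrix.mul_apply, A, Matrix.one_apply, mul_comm] using this
  refine ⟨⟨A, hU⟩, ?_⟩
  funext ⟨x, z⟩
  rw [one_kronecker_mulVec_apply, ← hA (v x) z, hL]

end Gram

/-! ### Existence and uniqueness of the uniform law on purifications. -/

section UniformPurification

variable {d : ℕ}

/-- The vector `ψ` rotated by `I ⊗ U`. -/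
def rotate (U : Matrix.unitaryGroup (Fin d) ℂ) (ψ : Fin d × Fin d → ℂ) : Fin d × Fin d → ℂ :=
  ((1 : Matrix (Fin d) (Fin d) ℂ) ⊗ₖ (U : Matrix (Fin d) (Fin d) ℂ)).mulVec ψ

lemma rotate_mul (U V : Matrix.unitaryGroup (Fin d) ℂ) (ψ : Fin d × Fin d → ℂ) :
    rotate (U * V) ψ = rotate U (rotate V ψ) := by
  rw [rotate, rotate, rotate, Matrix.mulVec_mulVec, ← Matrix.mul_kronecker_mul, one_mul]
  rfl

lemma continuous_rotate_of_continuous {X : Type*} [TopologicalSpace X]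
    {f : X → Matrix.unitaryGroup (Fin d) ℂ} {g : X → Fin d × Fin d → ℂ} (hf : Continuous f)
    (hg : Continuous g) : Continuous fun a => rotate (f a) (g a) := by
  refine continuous_pi fun ⟨x, z⟩ => ?_
  simp only [rotate, one_kronecker_mulVec_apply]
  refine continuous_finsetSum _ fun w _ => ?_
  exact ((continuous_subtype_val.comp hf).matrix_elem _ _).mul
    ((continuous_apply (x, w)).comp hg)

lemma continuous_rotate :
    Continuous fun p : Matrix.unitaryGroup (Fin d) ℂ × (Fin d × Fin d → ℂ) => rotate p.1 p.2 :=
  continuous_rotate_of_continuous continuous_fst continuous_snd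

lemma continuous_rotate_left (ψ : Fin d × Fin d → ℂ) :
    Continuous fun U : Matrix.unitaryGroup (Fin d) ℂ => rotate U ψ :=
  continuous_rotate_of_continuous continuous_id continuous_const

lemma continuous_rotate_right (U : Matrix.unitaryGroup (Fin d) ℂ) :
    Continuous (rotate U) :=
  continuous_rotate_of_continuous continuous_const continuous_id

lemma partialTrace_proj_rotate (U : Matrix.unitaryGroup (Fin d) ℂ) (ψ : Fin d × Fin d → ℂ) :
    partialTrace (proj (rotate U ψ)) = partialTrace (proj ψ) := by
  ext x y
  have h : ∀ φ : Fin d × Fin d → ℂ, partialTrace (proj φ) x y =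
      (fun z => φ (x, z)) ⬝ᵥ star (fun z => φ (y, z)) := fun φ => rfl
  have hr : ∀ x, (fun z => rotate U ψ (x, z)) =
      (U : Matrix (Fin d) (Fin d) ℂ).mulVec (fun z => ψ (x, z)) := fun x =>
    funext fun z => one_kronecker_mulVec_apply _ _ _ _
  rw [h, h, hr, hr, Matrix.star_mulVec, dotProduct_comm, Matrix.dotProduct_mulVec,
    Matrix.vecMul_vecMul, ← Matrix.star_eq_conjTranspose, Matrix.mem_unitaryGroup_iff'.mp U.2,
    Matrix.vecMul_one, dotProduct_comm]

lemma stdPurification_mem_purifications {σ : Matrix (Fin d) (Fin d) ℂ} (hσ : σ.PosSemidef) :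
    stdPurification σ ∈ purifications σ := by
  have hsa : (CFC.sqrt σ).conjTranspose = CFC.sqrt σ := (CFC.sqrt_nonneg σ).isSelfAdjoint
  have hsq := CFC.sqrt_mul_sqrt_self σ (Matrix.nonneg_iff_posSemidef.mpr hσ)
  have h : partialTrace (proj (stdPurification σ)) =
      CFC.sqrt σ * (CFC.sqrt σ).conjTranspose := by
    rw [stdPurification_eq]
    rfl
  exact h.trans (by rw [hsa, hsq])

/-- The distribution of `(I ⊗ U) ψ` for a Haar random unitary `U`. -/
noncomputable def haarOrbit (ψ : Fin d × Fin d → ℂ) : Measure (Fin d × Fin d → ℂ) :=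
  (haarUnitary d).map fun U => rotate U ψ

/-- By right invariance of Haar measure, the law depends only on the orbit of `ψ`. -/
lemma haarOrbit_rotate (V : Matrix.unitaryGroup (Fin d) ℂ) (ψ : Fin d × Fin d → ℂ) :
    haarOrbit (rotate V ψ) = haarOrbit ψ := by
  have h := map_mul_right_eq_self (haarUnitary d) V
  rw [haarOrbit, haarOrbit]
  conv_rhs => rw [← h]
  rw [Measure.map_map (continuous_rotate_left _).measurable (measurable_mul_const V)]
  congr 1
  funext U
  exact (rotate_mul U V ψ).symm

lemma isUniformPurification_haarOrbit {σ : Matrix (Fin d) (Fin d) ℂ} {ψ : Fin d × Fin d → ℂ}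
    (hψ : ψ ∈ purifications σ) : IsUniformPurification σ (haarOrbit ψ) where
  isProbability :=
    Measure.isProbabilityMeasure_map (continuous_rotate_left ψ).measurable.aemeasurable
  ae_mem := by
    have hclosed : MeasurableSet {φ : Fin d × Fin d → ℂ | φ ∈ purifications σ} := by
      refine (isClosed_eq ?_ continuous_const).measurableSet
      refine continuous_matrix fun x y => ?_
      simp only [partialTrace, proj, Matrix.of_apply, Matrix.vecMulVec_apply, Pi.star_apply]
      fun_prop
    rw [haarOrbit, ae_map_iff (continuous_rotate_left ψ).measurable.aemeasurable hclosed]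
    exact Filter.Eventually.of_forall fun U => (partialTrace_proj_rotate U ψ).trans hψ
  invariant V := by
    change (haarOrbit ψ).map (rotate V) = haarOrbit ψ
    have h := map_mul_left_eq_self (haarUnitary d) V
    rw [haarOrbit, Measure.map_map (continuous_rotate_right V).measurable
      (continuous_rotate_left ψ).measurable]
    conv_rhs => rw [← h]
    rw [Measure.map_map (continuous_rotate_left ψ).measurable (measurable_const_mul V)]
    congr 1
    funext U
    exact (rotate_mul V U ψ).symm

/-- Average the invariance of `ν` over Haar measure and swap the integrals: `ν` becomes a mixture of
the laws `haarOrbit φ`, all equal for purifications `φ` by transitivity. -/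
lemma IsUniformPurification.eq_haarOrbit {σ : Matrix (Fin d) (Fin d) ℂ}
    {ν : Measure (Fin d × Fin d → ℂ)} (hν : IsUniformPurification σ ν) {ψ : Fin d × Fin d → ℂ}
    (hψ : ψ ∈ purifications σ) : ν = haarOrbit ψ := by
  have := hν.isProbability
  have hconst : ∀ᵐ φ ∂ν, haarOrbit φ = haarOrbit ψ := by
    filter_upwards [hν.ae_mem] with φ hφ
    obtain ⟨V, hV⟩ := exists_unitary_mulVec_eq (ψ := ψ) (φ := φ) (hψ.trans hφ.symm)
    rw [← haarOrbit_rotate V ψ, rotate, hV]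
  ext B hB
  have hmeas : Measurable fun p : Matrix.unitaryGroup (Fin d) ℂ × (Fin d × Fin d → ℂ) =>
      B.indicator (1 : (Fin d × Fin d → ℂ) → ENNReal) (rotate p.1 p.2) :=
    (measurable_one.indicator hB).comp continuous_rotate.measurable
  have h1 : ∀ U, ∫⁻ φ, B.indicator (1 : (Fin d × Fin d → ℂ) → ENNReal) (rotate U φ) ∂ν = ν B := by
    intro U
    rw [← lintegral_map (measurable_one.indicator hB) (continuous_rotate_right U).measurable,
      lintegral_indicator_one hB]
    exact congrArg (fun μ : Measure (Fin d × Fin d → ℂ) => μ B) (hν.invariant U)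
  have h2 : ∀ φ, ∫⁻ U, B.indicator (1 : (Fin d × Fin d → ℂ) → ENNReal) (rotate U φ) ∂(haarUnitary d) =
      haarOrbit φ B := by
    intro φ
    rw [← lintegral_map (measurable_one.indicator hB) (continuous_rotate_left φ).measurable,
      lintegral_indicator_one hB]
    rfl
  calc ν B = ∫⁻ U, ∫⁻ φ, B.indicator (1 : (Fin d × Fin d → ℂ) → ENNReal) (rotate U φ) ∂ν ∂(haarUnitary d) := by
        simp [h1]
    _ = ∫⁻ φ, ∫⁻ U, B.indicator (1 : (Fin d × Fin d → ℂ) → ENNReal) (rotate U φ) ∂(haarUnitary d) ∂ν :=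
        lintegral_lintegral_swap hmeas.aemeasurable
    _ = ∫⁻ _, haarOrbit ψ B ∂ν := by
        refine lintegral_congr_ae ?_
        filter_upwards [hconst] with φ hφ
        rw [h2, hφ]
    _ = haarOrbit ψ B := by simp

end UniformPurification

/-! ### Tensor power states and their random purifications. -/

section TensorPowerStates

variable {n d : ℕ}

lemma tensorPow_posSemidef {ι : Type} [Fintype ι] [DecidableEq ι] {A : Matrix ι ι ℂ}
    (hA : A.PosSemidef) : (tensorPow n A).PosSemidef := by
  have hsa : (CFC.sqrt A).conjTranspose = CFC.sqrt A := (CFC.sqrt_nonneg A).isSelfAdjoint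
  rw [← CFC.sqrt_mul_sqrt_self A (Matrix.nonneg_iff_posSemidef.mpr hA), tensorPow_mul]
  nth_rw 1 [← hsa]
  rw [tensorPow_conjTranspose]
  exact Matrix.posSemidef_conjTranspose_mul_self _

lemma IsState.tensorPow {ι : Type} [Fintype ι] [DecidableEq ι] {σ : Matrix ι ι ℂ}
    (hσ : IsState σ) : IsState (tensorPow n σ) :=
  ⟨tensorPow_posSemidef hσ.posSemidef, by rw [trace_tensorPow, hσ.trace_eq_one, one_pow]⟩

/-- Uniqueness of the positive square root; it makes the standard purification of `σ^{⊗n}` factor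
over the `n` sites. -/
lemma sqrt_tensorPow {ι : Type} [Fintype ι] [DecidableEq ι] {A : Matrix ι ι ℂ}
    (hA : A.PosSemidef) : CFC.sqrt (tensorPow n A) = tensorPow n (CFC.sqrt A) := by
  refine CFC.sqrt_unique ?_ ?_
  · rw [← tensorPow_mul, CFC.sqrt_mul_sqrt_self A (Matrix.nonneg_iff_posSemidef.mpr hA)]
  · exact Matrix.nonneg_iff_posSemidef.mpr
      (tensorPow_posSemidef (Matrix.nonneg_iff_posSemidef.mp (CFC.sqrt_nonneg A)))

lemma rightRot_mulVec_stdPurification_tensorPow {σ : Matrix (Fin d) (Fin d) ℂ}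
    (hσ : σ.PosSemidef) (U : Matrix.unitaryGroup (Fin d) ℂ) (a b : Word n (Fin d)) :
    (rightRot n (U : Matrix (Fin d) (Fin d) ℂ)).mulVec (stdPurification (tensorPow n σ)) (a, b) =
      ∏ i, rotate U (stdPurification σ) (a i, b i) := by
  simp only [rightRot, rotate, one_kronecker_mulVec_apply]
  rw [Finset.prod_univ_sum, Fintype.piFinset_univ, stdPurification_eq, stdPurification_eq,
    sqrt_tensorPow hσ]
  simp only [tensorPow_apply, Finset.prod_mul_distrib]

lemma regroup_rotatedStd_tensorPow {σ : Matrix (Fin d) (Fin d) ℂ} (hσ : σ.PosSemidef)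
    (U : Matrix.unitaryGroup (Fin d) ℂ) :
    regroup (rotatedStd (tensorPow n σ) U) =
      tensorPow n (proj (rotate U (stdPurification σ))) := by
  have h : rotatedStd (tensorPow n σ) U = proj ((rightRot n (U : Matrix (Fin d) (Fin d) ℂ)).mulVec
      (stdPurification (tensorPow n σ))) := by
    rw [proj_mulVec, ← rightRot_conjTranspose]
    rfl
  ext x y
  rw [h, tensorPow_apply]
  simp only [regroup, Matrix.submatrix_apply, proj, Matrix.vecMulVec_apply, Pi.star_apply,
    rightRot_mulVec_stdPurification_tensorPow hσ, star_prod, Finset.prod_mul_distrib]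

lemma integral_tensorPow_proj_haarOrbit (ψ : Fin d × Fin d → ℂ) :
    ∫ φ, tensorPow n (proj φ) ∂(haarOrbit ψ) =
      ∫ U, tensorPow n (proj (rotate U ψ)) ∂(haarUnitary d) := by
  refine integral_map (continuous_rotate_left ψ).measurable.aemeasurable ?_
  have hc : Continuous fun φ : Fin d × Fin d → ℂ => tensorPow n (proj φ) := by
    refine continuous_matrix fun x y => ?_
    simp only [tensorPow_apply, proj, Matrix.vecMulVec_apply, Pi.star_apply]
    fun_prop
  exact hc.aestronglyMeasurable

end TensorPowerStates

end RandomPurification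

theorem mainTheorem2 (n d : ℕ) :
    ∃ P : Matrix (RandomPurification.Word n (Fin d)) (RandomPurification.Word n (Fin d)) ℂ →CP
        Matrix (RandomPurification.Word n (Fin d × Fin d))
          (RandomPurification.Word n (Fin d × Fin d)) ℂ,
      -- `P` is a quantum channel into the operators on the symmetric subspace
      (∀ X, (P X).trace = X.trace) ∧
      (∀ X, RandomPurification.SupportedOn
        (RandomPurification.symSubspace n (Fin d × Fin d)) (P X)) ∧
      -- all permutation-invariant states
      (∀ ρ : Matrix (RandomPurification.Word n (Fin d)) (RandomPurification.Word n (Fin d)) ℂ,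
        RandomPurification.IsState ρ → RandomPurification.IsPermInvariant ρ →
        P ρ = ∫ U, RandomPurification.regroup (RandomPurification.rotatedStd ρ U)
          ∂(RandomPurification.haarUnitary d)) ∧
      -- tensor power states
      (∀ σ : Matrix (Fin d) (Fin d) ℂ, RandomPurification.IsState σ →
        P (RandomPurification.tensorPow n σ) =
          ∫ U, RandomPurification.regroup
            (RandomPurification.rotatedStd (RandomPurification.tensorPow n σ) U)
            ∂(RandomPurification.haarUnitary d) ∧
        (∃! ν : MeasureTheory.Measure (Fin d × Fin d → ℂ),
          RandomPurification.IsUniformPurification σ ν) ∧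
        ∀ ν : MeasureTheory.Measure (Fin d × Fin d → ℂ),
          RandomPurification.IsUniformPurification σ ν →
          P (RandomPurification.tensorPow n σ) =
            ∫ ψ, RandomPurification.tensorPow n (RandomPurification.proj ψ) ∂ν) := by
  open RandomPurification in
  refine ⟨purifyChannel n d, trace_purifyChannel, supportedOn_purifyChannel,
    fun ρ hρ hinv => purifyChannel_of_isPermInvariant hρ.posSemidef hinv, fun σ hσ => ?_⟩
  have hP := purifyChannel_of_isPermInvariant (hσ.tensorPow (n := n)).posSemidef
    (isPermInvariant_tensorPow σ)
  have hmem := stdPurification_mem_purifications hσ.posSemidef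
  refine ⟨hP, ⟨haarOrbit (stdPurification σ), isUniformPurification_haarOrbit hmem,
    fun ν hν => hν.eq_haarOrbit hmem⟩, fun ν hν => ?_⟩
  rw [hP, hν.eq_haarOrbit hmem, integral_tensorPow_proj_haarOrbit]
  simp only [regroup_rotatedStd_tensorPow hσ.posSemidef]
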